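/- Let $X$ be a real Banach space with dual $X^*$, bidual $X^{**}$ and closed unit balls $B_X$, $B_{X^{**}}$. For a bounded sequence $(x^*_n)$ in $X^*$ put $$\delta_w(x^*_n)=\sup_{x^{**}\in B_{X^{**}}}\ \inf_{n\in\mathbb N}\ \sup_{k,l\ge n}|x^{**}(x^*_k)-x^{**}(x^*_l)|,\qquad \delta_{w^*}(x^*_n)=\sup_{x\in B_X}\ \inf_{n\in\mathbb N}\ \sup_{k,l\ge n}|x^*_k(x)-x^*_l(x)|.$$ For $c\ge 1$, the space $X$ is called $c$-Grothendieck if $\delta_w(x^*_n)\le c\,\delta_{w^*}(x^*_n)$ for every bounded sequence $(x^*_n)$ in $X^*$. Theorem. The space $\ell_\infty$ of bounded real sequences with the supremum norm is $1$-Grothendieck. That is, $\delta_w(x^*_n)\le\delta_{w^*}(x^*_n)$ for every bounded sequence $(x^*_n)$ in $(\ell_\infty)^*$. -/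

import Mathlib

open scoped ENNReal

/-- The measure of weak non-Cauchyness of a sequence `u` in the dual `X*` of a real normed space
`X`: the supremum over the closed unit ball of the bidual `X**` of
`inf_n sup_{k, l ≥ n} |x** (u k) - x** (u l)|`. It is computed in `[0, ∞]`, where every supremum
and infimum exists. -/
noncomputable def deltaWeak {X : Type*} [NormedAddCommGroup X] [NormedSpace ℝ X]
    (u : ℕ → StrongDual ℝ X) : ℝ≥0∞ :=
  ⨆ (φ : StrongDual ℝ (StrongDual ℝ X)) (_ : ‖φ‖ ≤ 1),
    ⨅ n : ℕ, ⨆ k ≥ n, ⨆ l ≥ n, ENNReal.ofReal |φ (u k) - φ (u l)|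

/-- The measure of weak* non-Cauchyness of a sequence `u` in the dual `X*` of a real normed space
`X`: the supremum over the closed unit ball of `X` of
`inf_n sup_{k, l ≥ n} |u k x - u l x|`. -/
noncomputable def deltaWeakStar {X : Type*} [NormedAddCommGroup X] [NormedSpace ℝ X]
    (u : ℕ → StrongDual ℝ X) : ℝ≥0∞ :=
  ⨆ (x : X) (_ : ‖x‖ ≤ 1),
    ⨅ n : ℕ, ⨆ k ≥ n, ⨆ l ≥ n, ENNReal.ofReal |u k x - u l x|

/-- A real Banach space `X` is `c`-Grothendieck, where `c ≥ 1`, if the measure of weak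
non-Cauchyness of every norm-bounded sequence in `X*` is at most `c` times its measure of weak*
non-Cauchyness. -/
def IsQuantGrothendieck (c : ℝ) (X : Type*) [NormedAddCommGroup X] [NormedSpace ℝ X]
    [CompleteSpace X] : Prop :=
  1 ≤ c ∧ ∀ u : ℕ → StrongDual ℝ X, Bornology.IsBounded (Set.range u) →
    deltaWeak u ≤ ENNReal.ofReal c * deltaWeakStar u

/-!
Suppose that `φ` in the bidual ball exceeds `δ` on every `v n`, where `v` is a bounded sequence
of functionals on `ℓ^∞`. It suffices to find, for every `ε > 0`, a point of the unit ball of `ℓ^∞`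
at which infinitely many `v n` are at least `δ - ε`: applied to differences of terms of the given
sequence, this compares the two measures of non-Cauchyness with constant `1`.

By Helly's theorem (`exists_norm_le_one_forall_lt_of_bidual`), for each `n` there are points of
the unit ball at which `v 0, …, v n` all exceed `δ`. These points form decreasing convex sets.
Let `m` be a weighted sum of the total variations `|v n|`, regarded as finitely additive measures.
Points of these sets which nearly minimize `y ↦ ∫ y² dm` are close to each other in `L²(m)`
(`exists_forall_near_of_parallelogram`). Hence there are a fixed `y₀` in the unit ball and, for
each `n`, a point `z n` of the unit ball with `v n (z n) > δ` and `z n` uniformly close to `y₀`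
off a set of small `m`.

By the subsequence splitting lemma (`IsCharge.exists_splitting`), along a subsequence `|v n|` is
small on all sets of small `m`, once they avoid a set `Q n`; here the sets `Q n` are disjoint, and
by Rosenthal's lemma (`IsCharge.rosenthal`) `|v n|` is small on the union of the other `Q k`. Let
`x` be equal to `z n` on each `Q n` and to `y₀` elsewhere; it belongs to `ℓ^∞` since a bounded
function pasted from infinitely many pieces is just a bounded function. Then `v n x` is close to
`v n (z n) > δ` along the subsequence (`exists_frequently_le_of_forall_finite`).
-/

open Filter Set
open scoped BoundedContinuousFunction

/-! ### Finitely additive set functions -/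

/-- A charge: a finitely additive function on all subsets of `α` with values in `[0, ∞]`. -/
structure IsCharge {α : Type*} (w : Set α → ℝ≥0∞) : Prop where
  empty : w ∅ = 0
  union : ∀ A B : Set α, Disjoint A B → w (A ∪ B) = w A + w B

namespace IsCharge

variable {α : Type*} {w : Set α → ℝ≥0∞}

theorem inter_add_diff (hw : IsCharge w) (A B : Set α) : w (A ∩ B) + w (A \ B) = w A := by
  rw [← hw.union _ _ (disjoint_sdiff_inter.symm), inter_union_sdiff]

theorem mono (hw : IsCharge w) {A B : Set α} (h : A ⊆ B) : w A ≤ w B := by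
  rw [← hw.inter_add_diff B A, inter_eq_self_of_subset_right h]
  exact le_self_add

theorem union_le (hw : IsCharge w) (A B : Set α) : w (A ∪ B) ≤ w A + w B := by
  rw [← union_sdiff_self, hw.union _ _ disjoint_sdiff_right]
  gcongr
  exact hw.mono sdiff_subset

theorem biUnion_le (hw : IsCharge w) {ι : Type*} (s : Finset ι) (E : ι → Set α) :
    w (⋃ i ∈ s, E i) ≤ ∑ i ∈ s, w (E i) := by
  classical
  induction s using Finset.induction_on with
  | empty => simp [hw.empty]
  | insert a s ha ih =>
    rw [Finset.set_biUnion_insert, Finset.sum_insert ha]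
    exact (hw.union_le _ _).trans (by gcongr)

theorem le_diff_biUnion_add (hw : IsCharge w) {ι : Type*} (A : Set α) (s : Finset ι)
    (E : ι → Set α) : w A ≤ w (A \ ⋃ i ∈ s, E i) + ∑ i ∈ s, w (E i) := by
  rw [← hw.inter_add_diff A (⋃ i ∈ s, E i), add_comm]
  gcongr
  exact (hw.mono inter_subset_right).trans (hw.biUnion_le s E)

theorem sum_le_univ (hw : IsCharge w) {ι : Type*} (s : Finset ι) (E : ι → Set α)
    (hE : (s : Set ι).PairwiseDisjoint E) : ∑ i ∈ s, w (E i) ≤ w univ := by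
  classical
  suffices h : ∑ i ∈ s, w (E i) = w (⋃ i ∈ s, E i) from h ▸ hw.mono (subset_univ _)
  induction s using Finset.induction_on with
  | empty => simp [hw.empty]
  | insert a s ha ih =>
    rw [Finset.set_biUnion_insert, Finset.sum_insert ha, hw.union,
      ih (hE.subset (by simp))]
    rw [disjoint_iUnion₂_right]
    intro i hi
    exact hE (by simp) (by simp [hi]) (by rintro rfl; exact ha hi)

end IsCharge

/-! ### Rosenthal's disjointness lemma -/

/-- Rosenthal's lemma by induction on a bound `K * ε` for the charges of the whole union: either
one of infinitely many disjoint subsequences works, or the bound drops by `ε` along some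
subsequence. -/
theorem IsCharge.exists_injective_le_of_le_mul {α : Type*} {ε : ℝ≥0∞} (hε' : ε ≠ ∞) (K : ℕ) :
    ∀ (w : ℕ → Set α → ℝ≥0∞) (Q : ℕ → Set α), (∀ n, IsCharge (w n)) →
      Pairwise (fun m n => Disjoint (Q m) (Q n)) → (∀ n, w n (⋃ m, Q m) ≤ K * ε) →
      ∃ g : ℕ → ℕ, g.Injective ∧ ∀ n, w (g n) (⋃ m ≠ n, Q (g m)) ≤ ε := by
  induction K with
  | zero =>
    intro w Q hw hQ h
    refine ⟨id, Function.injective_id, fun n => ?_⟩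
    refine ((hw n).mono (iUnion₂_subset fun m _ => subset_iUnion Q m)).trans ((h n).trans ?_)
    simp
  | succ K ih =>
    intro w Q hw hQ h
    by_cases hp : ∃ p, ∀ n, w (Nat.pair p n) (⋃ m ≠ n, Q (Nat.pair p m)) ≤ ε
    · obtain ⟨p, hp⟩ := hp
      exact ⟨Nat.pair p, fun a b hab => by simpa using hab, hp⟩
    · -- Every row of the array `Nat.pair p n` has a bad entry `q p`; along these entries the
      -- charge of the whole union drops by `ε`.
      push Not at hp
      choose q hq using hp
      have hinj : Function.Injective (fun p => Nat.pair p (q p)) := fun a b hab => by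
        simp only [Nat.pair_eq_pair] at hab
        exact hab.1
      obtain ⟨g, hg, hg'⟩ := ih (fun p => w (Nat.pair p (q p))) (fun p => Q (Nat.pair p (q p)))
        (fun p => hw _) (fun m n hmn => hQ (hinj.ne hmn)) (fun p => by
          have hd : Disjoint (⋃ m, Q (Nat.pair m (q m))) (⋃ m ≠ q p, Q (Nat.pair p m)) := by
            simp only [disjoint_iUnion_left, disjoint_iUnion_right]
            intro a ha b
            refine hQ fun hab => ?_
            rw [Nat.pair_eq_pair] at hab
            obtain ⟨rfl, h2⟩ := hab
            exact ha h2.symm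
          have h1 := (hw (Nat.pair p (q p))).union _ _ hd
          have h2 : w (Nat.pair p (q p))
              ((⋃ m, Q (Nat.pair m (q m))) ∪ (⋃ m ≠ q p, Q (Nat.pair p m))) ≤ (K + 1 : ℕ) * ε := by
            refine ((hw _).mono ?_).trans (h _)
            refine union_subset (iUnion_subset fun m => subset_iUnion Q _)
              (iUnion₂_subset fun m _ => subset_iUnion Q _)
          rw [h1] at h2
          have h3 : w (Nat.pair p (q p)) (⋃ m, Q (Nat.pair m (q m))) + ε ≤ K * ε + ε := by
            calc _ ≤ _ := add_le_add_right (hq p).le _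
              _ ≤ _ := h2
              _ = _ := by push_cast; ring
          exact (ENNReal.add_le_add_iff_right hε').1 h3)
      exact ⟨fun n => Nat.pair (g n) (q (g n)), hinj.comp hg, hg'⟩

/-- **Rosenthal's lemma**: given uniformly bounded charges `w n` and disjoint sets `Q n`, along
some subsequence each charge is small on the union of all the sets that do not belong to it. -/
theorem IsCharge.rosenthal {α : Type*} {w : ℕ → Set α → ℝ≥0∞} {Q : ℕ → Set α} {M ε : ℝ≥0∞}
    (hw : ∀ n, IsCharge (w n)) (hM : M ≠ ∞) (hwM : ∀ n, w n univ ≤ M)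
    (hQ : Pairwise (fun m n => Disjoint (Q m) (Q n))) (hε : ε ≠ 0) (hε' : ε ≠ ∞) :
    ∃ g : ℕ → ℕ, g.Injective ∧ ∀ n, w (g n) (⋃ m ≠ n, Q (g m)) ≤ ε := by
  obtain ⟨K, hK⟩ := ENNReal.exists_nat_mul_gt hε hM
  exact exists_injective_le_of_le_mul hε' K w Q hw hQ fun n =>
    ((hw n).mono (subset_univ _)).trans ((hwM n).trans hK.le)

/-! ### The subsequence splitting lemma for charges -/

theorem exists_pos_forall_finset_of_absolutelyContinuous {α : Type*} {w : ℕ → Set α → ℝ≥0∞}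
    {m : Set α → ℝ≥0∞} (hac : ∀ i, ∀ ε ≠ 0, ∃ t ≠ 0, ∀ E, m E < t → w i E ≤ ε)
    (s : Finset ℕ) {ε : ℝ≥0∞} (hε : ε ≠ 0) :
    ∃ t ≠ 0, ∀ i ∈ s, ∀ E, m E < t → w i E ≤ ε := by
  choose τ hτ0 hτ using fun i => hac i ε hε
  refine ⟨s.inf τ, ?_, fun i hi E hE => hτ i E (hE.trans_le (Finset.inf_le hi))⟩
  rw [← pos_iff_ne_zero, Finset.lt_inf_iff (by simp)]
  exact fun i _ => pos_iff_ne_zero.2 (hτ0 i)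

/-- If, along the ultrafilter `𝒰`, the charges `w i` have mass at least `c` on sets of
arbitrarily small `m`, then such sets may be chosen almost null for the later charges: among the
differences of many successive candidates, one is almost null by the pigeonhole principle. -/
theorem exists_concentration_set {α : Type*} {𝒰 : Ultrafilter ℕ} {w : ℕ → Set α → ℝ≥0∞}
    {m : Set α → ℝ≥0∞} {M c : ℝ≥0∞} (hw : ∀ n, IsCharge (w n)) (hM : M ≠ ∞)
    (hwM : ∀ n, w n univ ≤ M) (hm : IsCharge m)
    (hac : ∀ i, ∀ ε ≠ 0, ∃ t ≠ 0, ∀ E, m E < t → w i E ≤ ε)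
    (hc : ∀ t ≠ 0, ∀ᶠ i in 𝒰, ∃ E, m E < t ∧ c ≤ w i E)
    {p : ℕ → Prop} (hp : ∀ᶠ i in 𝒰, p i) {t ε : ℝ≥0∞} (ht : t ≠ 0) (hε : ε ≠ 0) :
    ∃ i P, p i ∧ m P < t ∧ c ≤ w i P + ε ∧ ∀ᶠ j in 𝒰, w j P ≤ ε := by
  classical
  obtain ⟨N, hN⟩ := ENNReal.exists_nat_mul_gt hε hM
  have hεN : ε / N ≠ 0 := by simp [hε]
  obtain ⟨f, hf, hf'⟩ := exists_seq_of_forall_finset_exists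
    (fun a : ℕ × Set α => p a.1 ∧ m a.2 < t ∧ c ≤ w a.1 a.2)
    (fun a b => w a.1 b.2 ≤ ε / N) (by
      intro s _
      obtain ⟨t', ht', h⟩ := exists_pos_forall_finset_of_absolutelyContinuous hac
        (s.image Prod.fst) hεN
      obtain ⟨i, hi, E, hE, hcE⟩ := (hp.and (hc (t ⊓ t') (by
        rw [← pos_iff_ne_zero] at *; exact lt_min ht ht'))).exists
      exact ⟨(i, E), ⟨hi, hE.trans_le inf_le_left, hcE⟩, fun x hx =>
        h _ (Finset.mem_image_of_mem _ hx) _ (hE.trans_le inf_le_right)⟩)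
  set P : ℕ → Set α := fun k => (f k).2 \ ⋃ l ∈ Finset.Ioo k N, (f l).2
  have hPc : ∀ k, c ≤ w (f k).1 (P k) + ε := fun k => by
    refine (hf k).2.2.trans (((hw _).le_diff_biUnion_add _ (Finset.Ioo k N)
      (fun l => (f l).2)).trans ?_)
    gcongr
    calc ∑ l ∈ Finset.Ioo k N, w (f k).1 (f l).2 ≤ ∑ l ∈ Finset.Ioo k N, ε / N :=
          Finset.sum_le_sum fun l hl => hf' k l (Finset.mem_Ioo.1 hl).1
      _ ≤ N * (ε / N) := by
          rw [Finset.sum_const, nsmul_eq_mul]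
          gcongr
          simp
          omega
      _ ≤ ε := ENNReal.mul_div_le
  have hPd : ((Finset.range N : Finset ℕ) : Set ℕ).PairwiseDisjoint P := by
    have key : ∀ k l, k < l → l < N → Disjoint (P k) (P l) := fun k l hkl hl =>
      disjoint_left.2 fun x hx hx' => hx.2 (mem_iUnion₂.2 ⟨l, by simp [hkl, hl], hx'.1⟩)
    intro k hk l hl hkl
    simp only [Finset.coe_range, mem_Iio] at hk hl
    rcases lt_or_gt_of_ne hkl with h | h
    · exact key k l h hl
    · exact (key l k h hk).symm
  by_contra! hcon
  have hlarge : ∀ k ∈ Finset.range N, ∀ᶠ j in 𝒰, ε < w j (P k) := fun k _ => by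
    have := hcon (f k).1 (P k) (hf k).1 ((hm.mono sdiff_subset).trans_lt (hf k).2.1) (hPc k)
    simpa only [not_eventually, not_le, Ultrafilter.frequently_iff_eventually] using this
  obtain ⟨j, hj⟩ := ((Filter.eventually_all_finset _).2 hlarge).exists
  refine absurd (((hw j).sum_le_univ _ P hPd).trans (hwM j)) (not_le.2 (hN.trans_le ?_))
  calc (N : ℝ≥0∞) * ε = ∑ k ∈ Finset.range N, ε := by simp
    _ ≤ _ := Finset.sum_le_sum fun k hk => (hj k hk).le

/-- The concentration constant of `w` along `𝒰`, up to `ε`: some `c` is attained on sets of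
arbitrarily small `m`, while `c + 2 * ε` is not attained on any set of small enough `m`. -/
theorem exists_concentration_constant {α : Type*} (𝒰 : Ultrafilter ℕ) {w : ℕ → Set α → ℝ≥0∞}
    {m : Set α → ℝ≥0∞} {M ε : ℝ≥0∞} (hw : ∀ n, IsCharge (w n)) (hM : M ≠ ∞)
    (hwM : ∀ n, w n univ ≤ M) (hm : IsCharge m) (hε : ε ≠ 0) (hε' : ε ≠ ∞) :
    ∃ c, (∀ t ≠ 0, ∀ᶠ i in 𝒰, ∃ E, m E < t ∧ c ≤ w i E) ∧
      ∃ t ≠ 0, ∀ᶠ i in 𝒰, ∀ E, m E < t → w i E < c + 2 * ε := by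
  set S : Set ℝ≥0∞ := {c | ∀ t ≠ 0, ∀ᶠ i in 𝒰, ∃ E, m E < t ∧ c ≤ w i E} with hS
  have hSM : sSup S ≤ M := sSup_le fun c hc => by
    obtain ⟨i, E, -, hE⟩ := (hc 1 one_ne_zero).exists
    exact hE.trans (((hw i).mono (subset_univ E)).trans (hwM i))
  have hS0 : (0 : ℝ≥0∞) ∈ S := fun t ht => Eventually.of_forall fun i =>
    ⟨∅, by rw [hm.empty]; exact pos_iff_ne_zero.2 ht, zero_le⟩
  have hex : ∃ c ∈ S, sSup S ≤ c + ε := by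
    rcases le_or_gt (sSup S) ε with h | h
    · exact ⟨0, hS0, by simpa using h⟩
    · have h1 : sSup S - ε < sSup S :=
        ENNReal.sub_lt_self (ne_top_of_le_ne_top hM hSM) (pos_of_gt h).ne' hε
      obtain ⟨c, hc, hlt⟩ := lt_sSup_iff.1 h1
      exact ⟨c, hc, tsub_le_iff_right.1 hlt.le⟩
  obtain ⟨c, hcS, hc⟩ := hex
  have hctop : c ≠ ∞ := ne_top_of_le_ne_top hM ((le_sSup hcS).trans hSM)
  have hlt : sSup S < c + 2 * ε := by
    refine hc.trans_lt ?_
    rw [two_mul, ← add_assoc]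
    exact ENNReal.lt_add_right (by simp [hctop, hε']) hε
  have hnot : c + 2 * ε ∉ S := fun h => absurd (le_sSup h) (not_le.2 hlt)
  refine ⟨c, hcS, ?_⟩
  simp only [hS, mem_ofPred_eq, not_forall, exists_prop] at hnot
  obtain ⟨t, ht, h⟩ := hnot
  refine ⟨t, ht, ?_⟩
  rw [← Ultrafilter.eventually_not] at h
  filter_upwards [h] with i hi E hE
  by_contra hcon
  exact hi ⟨E, hE, not_lt.1 hcon⟩

/-- **Subsequence splitting lemma** for charges, in the spirit of Kadec, Pełczyński and Rosenthal:
along a subsequence, the uniformly bounded charges `w i`, each absolutely continuous with respect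
to `m`, become uniformly absolutely continuous up to `ε` once each is restricted to the complement
of its own set `Q s`, where the sets `Q s` are disjoint. Moreover each charge is small on the
union of the sets `Q r` that do not belong to it. -/
theorem IsCharge.exists_splitting {α : Type*} {w : ℕ → Set α → ℝ≥0∞}
    {m : Set α → ℝ≥0∞} {M ε : ℝ≥0∞} (hw : ∀ n, IsCharge (w n)) (hM : M ≠ ∞)
    (hwM : ∀ n, w n univ ≤ M) (hm : IsCharge m)
    (hac : ∀ i, ∀ ε ≠ 0, ∃ t ≠ 0, ∀ E, m E < t → w i E ≤ ε) (hε : ε ≠ 0) (hε' : ε ≠ ∞) :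
    ∃ t ≠ 0, ∃ (i : ℕ → ℕ) (Q : ℕ → Set α), i.Injective ∧
      Pairwise (fun r s => Disjoint (Q r) (Q s)) ∧
      (∀ s F, m F < t → w (i s) (F \ Q s) ≤ ε) ∧
      ∀ s, w (i s) (⋃ r ≠ s, Q r) ≤ ε := by
  classical
  obtain ⟨η, hη, hη', hηε⟩ : ∃ η : ℝ≥0∞, η ≠ 0 ∧ η ≠ ∞ ∧ 4 * η = ε :=
    ⟨ε / 4, by simp [hε], ENNReal.div_ne_top hε' (by simp),
      ENNReal.mul_div_cancel (by simp) (by simp)⟩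
  let 𝒰 : Ultrafilter ℕ := hyperfilter ℕ
  obtain ⟨c, hc, t, ht, hct⟩ := exists_concentration_constant 𝒰 hw hM hwM hm hη hη'
  have ht2 : t / 2 ≠ 0 := by simp [ht]
  -- In a triple `(n, i, P)`, the rank `n` makes the errors `η * 2⁻¹ ^ (n + 1)` summable.
  obtain ⟨f, hf, hf'⟩ := exists_seq_of_forall_finset_exists
    (fun a : ℕ × ℕ × Set α => (∀ E, m E < t → w a.2.1 E < c + 2 * η) ∧ m a.2.2 < t / 2 ∧
      c ≤ w a.2.1 a.2.2 + η ∧ ∀ᶠ j in 𝒰, w j a.2.2 ≤ η * 2⁻¹ ^ (a.1 + 1))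
    (fun a b => a.1 < b.1 ∧ a.2.1 < b.2.1 ∧ w b.2.1 a.2.2 ≤ η * 2⁻¹ ^ (a.1 + 1)) (by
      intro s hs
      set n := s.sup Prod.fst + 1 with hn
      have h1 : ∀ᶠ j in 𝒰, ∀ x ∈ s, x.2.1 < j ∧ w j x.2.2 ≤ η * 2⁻¹ ^ (x.1 + 1) := by
        rw [Filter.eventually_all_finset]
        intro x hx
        refine Eventually.and ?_ (hs x hx).2.2.2
        exact (Nat.hyperfilter_le_atTop) (eventually_gt_atTop _)
      have hδ : η * 2⁻¹ ^ (n + 1) ≠ 0 := mul_ne_zero hη (pow_ne_zero _ (by simp))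
      obtain ⟨i, P, ⟨hi1, hi2⟩, hmP, hcP, hP⟩ := exists_concentration_set hw hM hwM hm hac hc
        (h1.and hct) ht2 hδ
      refine ⟨(n, i, P), ⟨hi2, hmP, hcP.trans ?_, hP⟩, fun x hx => ⟨?_, hi1 x hx⟩⟩
      · gcongr
        exact mul_le_of_le_one_right' (pow_le_one₀ (by simp) (by simp))
      · exact Nat.lt_succ_of_le (Finset.le_sup (f := Prod.fst) hx))
  have hmono : StrictMono fun s => (f s).1 := fun a b h => (hf' a b h).1
  have hinj : StrictMono fun s => (f s).2.1 := fun a b h => (hf' a b h).2.1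
  set Q : ℕ → Set α := fun s => (f s).2.2 \ ⋃ r ∈ Finset.range s, (f r).2.2
  have hQd : Pairwise (fun r s => Disjoint (Q r) (Q s)) := by
    have key : ∀ r s, r < s → Disjoint (Q r) (Q s) := fun r s hrs =>
      disjoint_left.2 fun x hx hx' => hx'.2 (mem_iUnion₂.2 ⟨r, by simp [hrs], hx.1⟩)
    intro r s hrs
    rcases lt_or_gt_of_ne hrs with h | h
    · exact key r s h
    · exact (key s r h).symm
  have hQc : ∀ s, c ≤ w (f s).2.1 (Q s) + 2 * η := fun s => by
    have h1 := (hw (f s).2.1).le_diff_biUnion_add (f s).2.2 (Finset.range s) (fun r => (f r).2.2)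
    have h2 : ∑ r ∈ Finset.range s, w (f s).2.1 (f r).2.2 ≤ η := by
      calc ∑ r ∈ Finset.range s, w (f s).2.1 (f r).2.2
          ≤ ∑ r ∈ Finset.range s, η * 2⁻¹ ^ (r + 1) := by
            refine Finset.sum_le_sum fun r hr => (hf' r s (Finset.mem_range.1 hr)).2.2.trans ?_
            refine mul_le_mul_right ?_ η
            exact pow_le_pow_of_le_one zero_le
              (ENNReal.inv_le_one.2 one_le_two) (Nat.succ_le_succ (hmono.le_apply (x := r)))
        _ ≤ ∑' r : ℕ, η * 2⁻¹ ^ (r + 1) := ENNReal.sum_le_tsum _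
        _ = η := by
            rw [ENNReal.tsum_mul_left, ENNReal.tsum_geometric_add_one]
            simp [ENNReal.inv_mul_cancel]
    calc c ≤ w (f s).2.1 (f s).2.2 + η := (hf s).2.2.1
      _ ≤ (w (f s).2.1 (Q s) + η) + η := by gcongr; exact h1.trans (by gcongr)
      _ = _ := by ring
  obtain ⟨g, hg, hg'⟩ := IsCharge.rosenthal (w := fun s => w (f s).2.1) (Q := Q)
    (fun n => hw _) hM (fun n => hwM _) hQd hε hε'
  refine ⟨t / 2, ht2, fun s => (f (g s)).2.1, fun s => Q (g s), hinj.injective.comp hg,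
    fun r s hrs => hQd (hg.ne hrs), fun s F hF => ?_, hg'⟩
  have hmQ : m (F ∪ Q (g s)) < t := by
    refine (hm.union_le _ _).trans_lt ?_
    calc m F + m (Q (g s)) < t / 2 + t / 2 :=
          ENNReal.add_lt_add hF ((hm.mono sdiff_subset).trans_lt (hf (g s)).2.1)
      _ = t := ENNReal.add_halves t
  have h1 := (hf (g s)).1 _ hmQ
  rw [← sdiff_union_self, (hw _).union _ _ disjoint_sdiff_left] at h1
  have h2 : w (f (g s)).2.1 (F \ Q (g s)) + w (f (g s)).2.1 (Q (g s))
      ≤ 4 * η + w (f (g s)).2.1 (Q (g s)) := by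
    calc _ ≤ c + 2 * η := h1.le
      _ ≤ (w (f (g s)).2.1 (Q (g s)) + 2 * η) + 2 * η := by gcongr; exact hQc _
      _ = _ := by ring
  rw [← hηε]
  exact (ENNReal.add_le_add_iff_right
    (ne_top_of_le_ne_top hM (((hw _).mono (subset_univ _)).trans (hwM _)))).1 h2

/-! ### The total variation of a functional on bounded functions -/

section TotalVariation

variable {α : Type*} [TopologicalSpace α]

/-- The total variation `|v|` of a bounded functional `v` on `α →ᵇ ℝ`, evaluated at a nonnegative
function `f : α → ℝ`: the supremum of `|v g|` over `|g| ≤ f`. It is taken in `[0, ∞]`, so that `f`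
need not be bounded. -/
noncomputable def totalVar (v : StrongDual ℝ (α →ᵇ ℝ)) (f : α → ℝ) : ℝ≥0∞ :=
  ⨆ g : {g : α →ᵇ ℝ // ∀ a, |g a| ≤ f a}, ‖v g‖ₑ

theorem enorm_le_totalVar (v : StrongDual ℝ (α →ᵇ ℝ)) {f : α → ℝ} {g : α →ᵇ ℝ}
    (h : ∀ a, |g a| ≤ f a) : ‖v g‖ₑ ≤ totalVar v f :=
  le_iSup (fun g : {g : α →ᵇ ℝ // ∀ a, |g a| ≤ f a} => ‖v g‖ₑ) ⟨g, h⟩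

theorem totalVar_mono (v : StrongDual ℝ (α →ᵇ ℝ)) {f h : α → ℝ} (hfh : f ≤ h) :
    totalVar v f ≤ totalVar v h :=
  iSup_le fun g => enorm_le_totalVar v fun a => (g.2 a).trans (hfh a)

theorem totalVar_le (v : StrongDual ℝ (α →ᵇ ℝ)) {f : α → ℝ} {M C : ℝ} (hM : ‖v‖ ≤ M)
    (hC : 0 ≤ C) (hf : ∀ a, f a ≤ C) : totalVar v f ≤ ENNReal.ofReal (M * C) := by
  refine iSup_le fun g => ?_
  rw [← ofReal_norm]
  refine ENNReal.ofReal_le_ofReal ((v.le_opNorm _).trans ?_)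
  gcongr
  · exact (norm_nonneg v).trans hM
  · exact (BoundedContinuousFunction.norm_le hC).2 fun a => (g.2 a).trans (hf a)

theorem totalVar_zero (v : StrongDual ℝ (α →ᵇ ℝ)) : totalVar v 0 = 0 := by
  simpa using totalVar_le v (f := 0) le_rfl le_rfl (fun a => le_rfl)

/-- Additivity on nonnegative functions; it rests on the Riesz decomposition of a function `g`
with `|g| ≤ f + h` as the truncation of `g` to `[-f, f]` plus a function bounded by `h`. -/
theorem totalVar_add [DiscreteTopology α] (v : StrongDual ℝ (α →ᵇ ℝ)) {f h : α → ℝ} (hf : 0 ≤ f) (hh : 0 ≤ h) :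
    totalVar v (f + h) = totalVar v f + totalVar v h := by
  apply le_antisymm
  · refine iSup_le fun ⟨g, hg⟩ => ?_
    have hle : ∀ a, |max (-f a) (min (g a) (f a))| ≤ |g a| := fun a => by
      have := hf a
      simp only [Pi.zero_apply] at this
      rcases abs_cases (g a) with ⟨h1, h2⟩ | ⟨h1, h2⟩ <;> rw [h1, abs_le] <;> constructor <;> grind
    let g₁ : α →ᵇ ℝ := BoundedContinuousFunction.ofNormedAddCommGroupDiscrete
      (fun a => max (-f a) (min (g a) (f a))) ‖g‖ fun a => (hle a).trans (g.norm_coe_le_norm a)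
    have hg₁ : ∀ a, g₁ a = max (-f a) (min (g a) (f a)) := fun a => rfl
    have h1 : ∀ a, |g₁ a| ≤ f a := fun a => by
      have := hf a
      simp only [Pi.zero_apply] at this
      rw [hg₁, abs_le]
      constructor <;> grind
    have h2 : ∀ a, |(g - g₁) a| ≤ h a := fun a => by
      have h3 := hf a
      have h4 := hh a
      have h5 := abs_le.1 (hg a)
      simp only [Pi.zero_apply, Pi.add_apply] at h3 h4 h5
      rw [BoundedContinuousFunction.sub_apply, hg₁, abs_le]
      constructor <;> grind
    calc ‖v g‖ₑ = ‖v g₁ + v (g - g₁)‖ₑ := by rw [← map_add]; congr 2; abel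
      _ ≤ ‖v g₁‖ₑ + ‖v (g - g₁)‖ₑ := enorm_add_le _ _
      _ ≤ _ := add_le_add (enorm_le_totalVar v h1) (enorm_le_totalVar v h2)
  · have : Nonempty {g : α →ᵇ ℝ // ∀ a, |g a| ≤ f a} := ⟨⟨0, fun a => by simpa using hf a⟩⟩
    have : Nonempty {g : α →ᵇ ℝ // ∀ a, |g a| ≤ h a} := ⟨⟨0, fun a => by simpa using hh a⟩⟩
    refine ENNReal.iSup_add_iSup_le fun ⟨g₁, h1⟩ ⟨g₂, h2⟩ => ?_
    have hadd : ‖v g₁ + v g₂‖ₑ ≤ totalVar v (f + h) := by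
      rw [← map_add]
      exact enorm_le_totalVar v fun a => (abs_add_le _ _).trans (add_le_add (h1 a) (h2 a))
    have hsub : ‖v g₁ - v g₂‖ₑ ≤ totalVar v (f + h) := by
      rw [← map_sub]
      exact enorm_le_totalVar v fun a => (abs_sub _ _).trans (add_le_add (h1 a) (h2 a))
    rcases le_total (v g₁) 0 with h3 | h3 <;> rcases le_total (v g₂) 0 with h4 | h4
    all_goals
      simp only [← ofReal_norm, Real.norm_eq_abs] at hadd hsub ⊢
      rw [← ENNReal.ofReal_add (abs_nonneg _) (abs_nonneg _)]
    · rwa [abs_of_nonpos h3, abs_of_nonpos h4, ← neg_add, ← abs_of_nonpos (add_nonpos h3 h4)]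
    · rwa [abs_of_nonpos h3, abs_of_nonneg h4, neg_add_eq_sub, ← abs_of_nonneg (sub_nonneg.2
        (h3.trans h4)), abs_sub_comm]
    · rwa [abs_of_nonneg h3, abs_of_nonpos h4, ← sub_eq_add_neg, ← abs_of_nonneg (sub_nonneg.2
        (h4.trans h3))]
    · rwa [abs_of_nonneg h3, abs_of_nonneg h4, ← abs_of_nonneg (add_nonneg h3 h4)]

theorem ofReal_mul_totalVar_le (v : StrongDual ℝ (α →ᵇ ℝ)) {f : α → ℝ} {c : ℝ} (hc : 0 ≤ c) :
    ENNReal.ofReal c * totalVar v f ≤ totalVar v (c • f) := by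
  rw [totalVar, ENNReal.mul_iSup]
  refine iSup_le fun ⟨g, hg⟩ => ?_
  have : ENNReal.ofReal c * ‖v g‖ₑ = ‖v (c • g)‖ₑ := by
    rw [map_smul, enorm_smul, Real.enorm_of_nonneg hc]
  rw [this]
  refine enorm_le_totalVar v fun a => ?_
  simp only [BoundedContinuousFunction.coe_smul, Pi.smul_apply, smul_eq_mul, abs_mul,
    abs_of_nonneg hc]
  exact mul_le_mul_of_nonneg_left (hg a) hc

theorem isCharge_totalVar [DiscreteTopology α] (v : StrongDual ℝ (α →ᵇ ℝ)) :
    IsCharge fun E : Set α => totalVar v (E.indicator 1) where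
  empty := by rw [indicator_empty]; exact totalVar_zero v
  union A B h := by
    rw [indicator_union_of_disjoint h]
    exact totalVar_add v (indicator_nonneg fun _ _ => zero_le_one)
      (indicator_nonneg fun _ _ => zero_le_one)

/-- The weighted sum of the total variations of the functionals `v i`, which controls all of
them. -/
noncomputable def controlVar (v : ℕ → StrongDual ℝ (α →ᵇ ℝ)) (f : α → ℝ) : ℝ≥0∞ :=
  ∑' i, 2⁻¹ ^ (i + 1) * totalVar (v i) f

variable {v : ℕ → StrongDual ℝ (α →ᵇ ℝ)}

theorem controlVar_add [DiscreteTopology α] {f h : α → ℝ} (hf : 0 ≤ f) (hh : 0 ≤ h) :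
    controlVar v (f + h) = controlVar v f + controlVar v h := by
  simp only [controlVar, totalVar_add _ hf hh, mul_add, ENNReal.tsum_add]

theorem controlVar_mono {f h : α → ℝ} (hfh : f ≤ h) : controlVar v f ≤ controlVar v h :=
  ENNReal.tsum_le_tsum fun i => by gcongr; exact totalVar_mono _ hfh

theorem ofReal_mul_controlVar_le {f : α → ℝ} {c : ℝ} (hc : 0 ≤ c) :
    ENNReal.ofReal c * controlVar v f ≤ controlVar v (c • f) := by
  rw [controlVar, ← ENNReal.tsum_mul_left]
  refine ENNReal.tsum_le_tsum fun i => ?_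
  rw [mul_left_comm]
  gcongr
  exact ofReal_mul_totalVar_le _ hc

theorem controlVar_le {f : α → ℝ} {M C : ℝ} (hM : ∀ i, ‖v i‖ ≤ M) (hC : 0 ≤ C)
    (hf : ∀ a, f a ≤ C) : controlVar v f ≤ ENNReal.ofReal (M * C) := by
  calc controlVar v f ≤ ∑' i : ℕ, 2⁻¹ ^ (i + 1) * ENNReal.ofReal (M * C) :=
        ENNReal.tsum_le_tsum fun i => by gcongr; exact totalVar_le _ (hM i) hC hf
    _ = _ := by
        rw [ENNReal.tsum_mul_right, ENNReal.tsum_geometric_add_one]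
        simp [ENNReal.inv_mul_cancel]

theorem isCharge_controlVar [DiscreteTopology α] (v : ℕ → StrongDual ℝ (α →ᵇ ℝ)) :
    IsCharge fun E : Set α => controlVar v (E.indicator 1) where
  empty := by simp only [controlVar, (isCharge_totalVar _).empty, mul_zero, tsum_zero]
  union A B h := by
    simp only [controlVar, (isCharge_totalVar _).union A B h, mul_add, ENNReal.tsum_add]

theorem totalVar_absolutelyContinuous (v : ℕ → StrongDual ℝ (α →ᵇ ℝ)) (i : ℕ) (ε : ℝ≥0∞)
    (hε : ε ≠ 0) : ∃ t ≠ 0, ∀ E : Set α, controlVar v (E.indicator 1) < t →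
      totalVar (v i) (E.indicator 1) ≤ ε := by
  have h2 : (2⁻¹ : ℝ≥0∞) ^ (i + 1) ≠ 0 := pow_ne_zero _ (by simp)
  have h2' : (2⁻¹ : ℝ≥0∞) ^ (i + 1) ≠ ∞ := ENNReal.pow_ne_top (by simp)
  refine ⟨2⁻¹ ^ (i + 1) * ε, mul_ne_zero h2 hε, fun E hE => ?_⟩
  have h := (ENNReal.le_tsum i).trans hE.le
  exact (ENNReal.mul_le_mul_iff_right h2 h2').1 h

end TotalVariation

/-! ### Nearly minimal points for a quadratic functional -/

/-- For a decreasing sequence of midpoint convex sets and a functional satisfying the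
parallelogram law, some `y₀` is close to points of every one of the sets: nearly minimal points of
the sets of large index are close to each other. -/
theorem exists_forall_near_of_parallelogram {X : Type*} [AddCommGroup X] [Module ℝ X]
    {q : X → ℝ≥0∞} {C : ℕ → Set X} {R τ : ℝ≥0∞}
    (hq : ∀ y z, q (z - y) + 4 * q ((2⁻¹ : ℝ) • (y + z)) = 2 * q y + 2 * q z)
    (hC : Antitone C) (hmid : ∀ n, ∀ y ∈ C n, ∀ z ∈ C n, (2⁻¹ : ℝ) • (y + z) ∈ C n)
    (hne : ∀ n, (C n).Nonempty) (hR : R ≠ ∞) (hqR : ∀ n, ∀ y ∈ C n, q y ≤ R) (hτ : τ ≠ 0) :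
    ∃ y₀ ∈ C 0, ∀ n, ∃ z ∈ C n, q (z - y₀) ≤ 8 * τ := by
  set d : ℝ≥0∞ := ⨆ n, ⨅ y ∈ C n, q y with hd
  have hdR : d ≤ R := iSup_le fun n => by
    obtain ⟨y, hy⟩ := hne n
    exact (iInf₂_le y hy).trans (hqR n y hy)
  have hdtop : d ≠ ∞ := ne_top_of_le_ne_top hR hdR
  have hlt : d < d + τ := ENNReal.lt_add_right hdtop hτ
  have hnear : ∀ n, ∃ y ∈ C n, q y < d + τ := fun n => by
    have : ⨅ y ∈ C n, q y < d + τ := (le_iSup (fun n => ⨅ y ∈ C n, q y) n).trans_lt hlt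
    simpa only [iInf_lt_iff, exists_prop] using this
  have hlow : ∃ n, d ≤ (⨅ y ∈ C n, q y) + τ := by
    rcases le_or_gt d τ with h | h
    · exact ⟨0, h.trans le_add_self⟩
    · obtain ⟨n, hn⟩ := lt_iSup_iff.1 (ENNReal.sub_lt_self hdtop (pos_of_gt h).ne' hτ)
      exact ⟨n, tsub_le_iff_right.1 hn.le⟩
  obtain ⟨n₀, hn₀⟩ := hlow
  obtain ⟨y, hy, hqy⟩ := hnear n₀
  refine ⟨y, hC (Nat.zero_le _) hy, fun n => ?_⟩
  obtain ⟨z, hz, hqz⟩ := hnear (max n n₀)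
  refine ⟨z, hC (le_max_left _ _) hz, ?_⟩
  have hm : d ≤ q ((2⁻¹ : ℝ) • (y + z)) + τ := hn₀.trans (by
    gcongr
    exact iInf₂_le _ (hmid n₀ y hy z (hC (le_max_right _ _) hz)))
  have : q (z - y) + 4 * d ≤ 8 * τ + 4 * d := by
    calc q (z - y) + 4 * d ≤ q (z - y) + 4 * (q ((2⁻¹ : ℝ) • (y + z)) + τ) := by gcongr
      _ = (q (z - y) + 4 * q ((2⁻¹ : ℝ) • (y + z))) + 4 * τ := by ring
      _ = (2 * q y + 2 * q z) + 4 * τ := by rw [hq]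
      _ ≤ (2 * (d + τ) + 2 * (d + τ)) + 4 * τ := by gcongr
      _ = _ := by ring
  exact (ENNReal.add_le_add_iff_right (ENNReal.mul_ne_top (by simp) hdtop)).1 this

/-! ### Pasting bounded functions -/

/-- If any finitely many terms of a bounded sequence of functionals on `α →ᵇ ℝ` are larger than
`δ` at some point of the unit ball, then infinitely many of them are at least `δ - ε` at a common point
of the unit ball. -/
theorem exists_frequently_le_of_forall_finite {α : Type*} [TopologicalSpace α]
    [DiscreteTopology α] {v : ℕ → StrongDual ℝ (α →ᵇ ℝ)} {M δ ε : ℝ} (hM : ∀ i, ‖v i‖ ≤ M)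
    (hv : ∀ n, ∃ y : α →ᵇ ℝ, ‖y‖ ≤ 1 ∧ ∀ i ≤ n, δ < v i y) (hε : 0 < ε) :
    ∃ x : α →ᵇ ℝ, ‖x‖ ≤ 1 ∧ ∃ᶠ n in atTop, δ - ε ≤ v n x := by
  classical
  have hM0 : 0 ≤ M := (norm_nonneg (v 0)).trans (hM 0)
  obtain ⟨t, ht, i, Q, hi, hQ, hsplit, hother⟩ := IsCharge.exists_splitting
    (fun n => isCharge_totalVar (v n)) (M := ENNReal.ofReal (M * 1)) (by simp)
    (fun n => totalVar_le (v n) (hM n) zero_le_one fun a => by simp) (isCharge_controlVar v)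
    (totalVar_absolutelyContinuous v) (ε := ENNReal.ofReal (ε / 8)) (by simpa using hε) (by simp)
  set η : ℝ := ε / (4 * (M + 1)) with hη
  have hη0 : 0 < η := by positivity
  have hηM : M * η ≤ ε / 4 := by
    rw [hη, mul_div_assoc', div_le_iff₀ (by positivity)]
    nlinarith
  obtain ⟨τ, hτ, hτt⟩ : ∃ τ : ℝ≥0∞, τ ≠ 0 ∧ 8 * τ < ENNReal.ofReal (η ^ 2) * t := by
    have h0 : ENNReal.ofReal (η ^ 2) * t ≠ 0 := mul_ne_zero (by simp [hη0.ne']) ht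
    obtain ⟨r, hr0, hr⟩ := exists_between (pos_iff_ne_zero.2 h0)
    refine ⟨r / 8, by simp [hr0.ne'], ?_⟩
    rwa [ENNReal.mul_div_cancel (by simp) (by simp)]
  -- The functional `y ↦ ∫ y²` for the control charge obeys the parallelogram law.
  obtain ⟨y₀, hy₀, hnear⟩ := exists_forall_near_of_parallelogram
    (q := fun y : α →ᵇ ℝ => controlVar v (fun a => y a ^ 2))
    (C := fun n => {y | ‖y‖ ≤ 1 ∧ ∀ i ≤ n, δ < v i y}) (R := ENNReal.ofReal (M * 1)) (τ := τ)
    (fun y z => by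
      have e4 : ∀ f : α → ℝ, 0 ≤ f →
          controlVar v (f + f + (f + f)) = 4 * controlVar v f := fun f hf => by
        rw [controlVar_add (add_nonneg hf hf) (add_nonneg hf hf), controlVar_add hf hf]
        ring
      have hsq : ∀ y : α →ᵇ ℝ, (0 : α → ℝ) ≤ fun a => y a ^ 2 := fun y a => sq_nonneg _
      rw [two_mul, two_mul, ← e4 _ (hsq _), ← controlVar_add (hsq _) (hsq _),
        ← controlVar_add (hsq _) (hsq _), ← controlVar_add (hsq _) (by
          have := hsq ((2⁻¹ : ℝ) • (y + z)); positivity),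
        ← controlVar_add (add_nonneg (hsq _) (hsq _)) (add_nonneg (hsq _) (hsq _))]
      congr 1
      ext a
      simp only [Pi.add_apply, BoundedContinuousFunction.sub_apply,
        BoundedContinuousFunction.coe_smul, BoundedContinuousFunction.coe_add, smul_eq_mul]
      ring)
    (fun m n hmn y hy => ⟨hy.1, fun i hi => hy.2 i (hi.trans hmn)⟩)
    (fun n y hy z hz => by
      refine ⟨?_, fun i hi => ?_⟩
      · rw [norm_smul, Real.norm_of_nonneg (by norm_num)]
        have := norm_add_le y z
        linarith [hy.1, hz.1]
      · have h1 := hy.2 i hi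
        have h2 := hz.2 i hi
        simp only [map_smul, map_add, smul_eq_mul]
        linarith)
    (fun n => hv n) (by simp)
    (fun n y hy => controlVar_le hM zero_le_one fun a => by
      have := (y.norm_coe_le_norm a).trans hy.1
      rwa [sq_le_one_iff_abs_le_one])
    hτ
  choose z hz hqz using hnear
  have hbd : ∀ y : α →ᵇ ℝ, ‖y‖ ≤ 1 → ∀ a, |y a| ≤ 1 := fun y hy a =>
    (y.norm_coe_le_norm a).trans hy
  -- The function `x` is `z (i s)` on each `Q s` and `y₀` elsewhere.
  set X : α → ℝ := fun a => if h : ∃ s, a ∈ Q s then z (i h.choose) a else y₀ a with hX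
  have hXQ : ∀ s, ∀ a ∈ Q s, X a = z (i s) a := fun s a ha => by
    have hex : ∃ s, a ∈ Q s := ⟨s, ha⟩
    have : hex.choose = s := by
      by_contra hne
      exact disjoint_left.1 (hQ hne) hex.choose_spec ha
    simp only [hX, dif_pos hex, this]
  have hX1 : ∀ a, |X a| ≤ 1 := fun a => by
    by_cases h : ∃ s, a ∈ Q s
    · obtain ⟨s, hs⟩ := h
      rw [hXQ s a hs]
      exact hbd _ (hz _).1 a
    · simp only [hX, dif_neg h]
      exact hbd _ hy₀.1 a
  set x : α →ᵇ ℝ := BoundedContinuousFunction.ofNormedAddCommGroupDiscrete X 1 hX1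
  have hxX : ∀ a, x a = X a := fun a => rfl
  refine ⟨x, (BoundedContinuousFunction.norm_le zero_le_one).2 hX1, ?_⟩
  suffices h : ∀ s, δ - ε ≤ v (i s) x from
    Nat.frequently_atTop_iff_infinite.2 ((infinite_range_of_injective hi).mono
      (range_subset_iff.2 h))
  intro s
  set F : Set α := {a | η ≤ |(z (i s) - y₀) a|} with hF
  have hFt : controlVar v (F.indicator 1) < t := by
    have h1 : ENNReal.ofReal (η ^ 2) * controlVar v (F.indicator 1)
        < ENNReal.ofReal (η ^ 2) * t := by
      refine (ofReal_mul_controlVar_le (sq_nonneg η)).trans_lt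
        (((controlVar_mono fun a => ?_).trans (hqz (i s))).trans_lt hτt)
      by_cases ha : a ∈ F
      · simp only [Pi.smul_apply, indicator_of_mem ha, Pi.one_apply, smul_eq_mul, mul_one]
        rw [← sq_abs ((z (i s) - y₀) a)]
        exact pow_le_pow_left₀ hη0.le ha 2
      · simp only [Pi.smul_apply, indicator_of_notMem ha, smul_zero]
        positivity
    exact lt_of_mul_lt_mul_left' h1
  set A : Set α := F \ Q s
  set B : Set α := ⋃ r ≠ s, Q r
  have hle : ∀ a, |(z (i s) - x) a| ≤
      ((fun _ => η) + ((A.indicator 1 + A.indicator 1) + (B.indicator 1 + B.indicator 1)) :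
        α → ℝ) a := fun a => by
    have hA0 : (0 : ℝ) ≤ A.indicator 1 a := indicator_nonneg (fun _ _ => zero_le_one) a
    have hB0 : (0 : ℝ) ≤ B.indicator 1 a := indicator_nonneg (fun _ _ => zero_le_one) a
    have h2 : |(z (i s) - x) a| ≤ 2 := by
      rw [BoundedContinuousFunction.sub_apply]
      exact (abs_sub _ _).trans ((add_le_add (hbd _ (hz (i s)).1 a) (hX1 a)).trans (by norm_num))
    simp only [Pi.add_apply]
    by_cases haQ : a ∈ Q s
    · rw [BoundedContinuousFunction.sub_apply, hxX, hXQ s a haQ, sub_self, abs_zero]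
      positivity
    by_cases haB : a ∈ B
    · rw [indicator_of_mem haB]
      simp only [Pi.one_apply]
      linarith
    by_cases haF : a ∈ F
    · have haA : a ∈ A := ⟨haF, haQ⟩
      rw [indicator_of_mem haA]
      simp only [Pi.one_apply]
      linarith
    · have hno : ¬∃ r, a ∈ Q r := by
        rintro ⟨r, hr⟩
        by_cases hrs : r = s
        · exact haQ (hrs ▸ hr)
        · exact haB (mem_iUnion₂.2 ⟨r, hrs, hr⟩)
      have hxa : (z (i s) - x) a = (z (i s) - y₀) a := by
        simp only [BoundedContinuousFunction.sub_apply, hxX, hX, dif_neg hno]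
      rw [hxa]
      have : |(z (i s) - y₀) a| < η := not_le.1 haF
      linarith
  have hfin : ‖v (i s) (z (i s) - x)‖ₑ ≤ ENNReal.ofReal ε := by
    have hA0 : (0 : α → ℝ) ≤ A.indicator 1 := indicator_nonneg fun _ _ => zero_le_one
    have hB0 : (0 : α → ℝ) ≤ B.indicator 1 := indicator_nonneg fun _ _ => zero_le_one
    refine (enorm_le_totalVar _ hle).trans ?_
    rw [totalVar_add _ (fun _ => hη0.le) (by positivity),
      totalVar_add _ (by positivity) (by positivity), totalVar_add _ hA0 hA0,
      totalVar_add _ hB0 hB0]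
    have hA := hsplit s F hFt
    have hB := hother s
    calc _ ≤ ENNReal.ofReal (ε / 4) + ((ENNReal.ofReal (ε / 8) + ENNReal.ofReal (ε / 8)) +
          (ENNReal.ofReal (ε / 8) + ENNReal.ofReal (ε / 8))) := by
          gcongr
          exact (totalVar_le _ (hM _) hη0.le fun _ => le_rfl).trans
            (ENNReal.ofReal_le_ofReal hηM)
      _ ≤ ENNReal.ofReal ε := by
          rw [← ENNReal.ofReal_add, ← ENNReal.ofReal_add, ← ENNReal.ofReal_add]
          · exact ENNReal.ofReal_le_ofReal (by linarith)
          all_goals positivity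
  rw [← ofReal_norm, ENNReal.ofReal_le_ofReal_iff hε.le, map_sub, Real.norm_eq_abs,
    abs_le] at hfin
  have := (hz (i s)).2 (i s) le_rfl
  linarith [hfin.2]

/-! ### Passing from the bidual to the space -/

/-- Helly's theorem in the form of finite-dimensional Goldstine density: what an element of the
bidual ball does to finitely many functionals is approximated by elements of the unit ball. -/
theorem exists_norm_le_one_forall_lt_of_bidual {X ι : Type*} [NormedAddCommGroup X]
    [NormedSpace ℝ X] [Finite ι] (v : ι → StrongDual ℝ X)
    {φ : StrongDual ℝ (StrongDual ℝ X)} (hφ : ‖φ‖ ≤ 1) {δ : ℝ} (h : ∀ i, δ < φ (v i)) :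
    ∃ y : X, ‖y‖ ≤ 1 ∧ ∀ i, δ < v i y := by
  have := Fintype.ofFinite ι
  classical
  let T : X →L[ℝ] (ι → ℝ) := ContinuousLinearMap.pi v
  have hmem : (fun i => φ (v i)) ∈ closure (T '' Metric.closedBall 0 1) := by
    by_contra hcon
    obtain ⟨f, u, hu, hfu⟩ := geometric_hahn_banach_closed_point
      (((convex_closedBall (0 : X) 1).linear_image T.toLinearMap).closure) isClosed_closure hcon
    have hf : ∀ p : ι → ℝ, f p = ∑ i, f (Pi.single i 1) * p i := fun p => by
      conv_lhs => rw [← Finset.univ_sum_single p, map_sum]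
      refine Finset.sum_congr rfl fun i _ => ?_
      have hsingle : Pi.single i (p i) = p i • (Pi.single i 1 : ι → ℝ) := by
        rw [← Pi.single_smul', smul_eq_mul, mul_one]
      rw [hsingle, map_smul, smul_eq_mul, mul_comm]
    set g : StrongDual ℝ X := ∑ i, f (Pi.single i 1) • v i with hg
    have hgT : ∀ y, g y = f (T y) := fun y => by
      rw [hf]
      simp [hg, T]
    have hgφ : φ g = f fun i => φ (v i) := by
      rw [hf]
      simp [hg]
    have hball : ∀ y : X, ‖y‖ ≤ 1 → g y < u := fun y hy => by
      rw [hgT]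
      exact hu _ (subset_closure ⟨y, by simpa using hy, rfl⟩)
    have hu0 : 0 < u := by simpa using hball 0 (by simp)
    have hgu : ‖g‖ ≤ u := by
      refine g.opNorm_le_of_unit_norm hu0.le fun y hy => ?_
      rw [Real.norm_eq_abs, abs_le]
      have h1 := hball y hy.le
      have h2 := hball (-y) (by simp [hy])
      rw [map_neg] at h2
      constructor <;> linarith
    have h3 : φ g ≤ ‖g‖ := by
      refine (le_abs_self _).trans ((φ.le_opNorm g).trans ?_)
      exact mul_le_of_le_one_left (norm_nonneg _) hφ
    linarith [hgφ ▸ hfu]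
  have hopen : IsOpen {p : ι → ℝ | ∀ i, δ < p i} := by
    simp only [ofPred_forall]
    exact isOpen_iInter_of_finite fun i => isOpen_lt continuous_const (continuous_apply i)
  obtain ⟨p, hp, y, hy, rfl⟩ := mem_closure_iff.1 hmem _ hopen h
  exact ⟨y, by simpa using hy, hp⟩

/-- If an element of the bidual ball is larger than `δ` on every term of a bounded sequence of
functionals on `ℓ^∞`, then infinitely many terms are at least `δ - ε` at a common point of the
unit ball of `ℓ^∞`. -/
theorem exists_norm_le_one_frequently_le_of_bidual {α : Type*}
    {v : ℕ → StrongDual ℝ (lp (fun _ : α => ℝ) ∞)} {M δ ε : ℝ} (hM : ∀ i, ‖v i‖ ≤ M)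
    {φ : StrongDual ℝ (StrongDual ℝ (lp (fun _ : α => ℝ) ∞))} (hφ : ‖φ‖ ≤ 1)
    (h : ∀ i, δ < φ (v i)) (hε : 0 < ε) :
    ∃ x : lp (fun _ : α => ℝ) ∞, ‖x‖ ≤ 1 ∧ ∃ᶠ n in atTop, δ - ε ≤ v n x := by
  let : TopologicalSpace α := ⊥
  have : DiscreteTopology α := ⟨rfl⟩
  let e : lp (fun _ : α => ℝ) ∞ ≃ₗᵢ[ℝ] (α →ᵇ ℝ) := lpBCFₗᵢ ℝ ℝ
  obtain ⟨x, hx, hfreq⟩ := exists_frequently_le_of_forall_finite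
    (v := fun i => (v i).comp (e.symm.toContinuousLinearEquiv : (α →ᵇ ℝ) →L[ℝ] _)) (M := M)
    (δ := δ) (ε := ε)
    (fun i => by
      refine ContinuousLinearMap.opNorm_le_bound _ ((norm_nonneg _).trans (hM i)) fun y => ?_
      exact ((v i).le_opNorm _).trans (mul_le_mul (hM i) (e.symm.norm_map y).le (norm_nonneg _)
        ((norm_nonneg _).trans (hM i))))
    (fun n => by
      obtain ⟨y, hy, hy'⟩ := exists_norm_le_one_forall_lt_of_bidual
        (fun i : Iic n => v i) hφ (fun i => h i)
      refine ⟨e y, by simpa using hy, fun i hi => ?_⟩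
      simpa using hy' ⟨i, hi⟩) hε
  exact ⟨e.symm x, by simpa using hx, hfreq⟩

theorem theorem1p2 : IsQuantGrothendieck 1 (lp (fun _ : ℕ => ℝ) ∞) := by
  refine ⟨le_rfl, fun u hu => ?_⟩
  rw [ENNReal.ofReal_one, one_mul]
  obtain ⟨M, hM⟩ := hu.exists_norm_le
  refine iSup₂_le fun φ hφ => le_of_forall_lt_imp_le_of_dense fun c hc => ?_
  obtain ⟨δ, hcδ, hδ⟩ := ENNReal.lt_iff_exists_nnreal_btwn.1 hc
  obtain ⟨δ', hcδ', hδ'⟩ := ENNReal.lt_iff_exists_nnreal_btwn.1 hcδ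
  have hδδ : (δ' : ℝ) < δ := by exact_mod_cast hδ'
  have hkl : ∀ n, ∃ k ≥ n, ∃ l ≥ n, (δ : ℝ) < φ (u k - u l) := fun n => by
    have h1 := hδ.trans_le (iInf_le _ n)
    simp only [lt_iSup_iff, exists_prop] at h1
    obtain ⟨k, hk, l, hl, h2⟩ := h1
    rw [ENNReal.lt_ofReal_iff_toReal_lt ENNReal.coe_ne_top, ENNReal.coe_toReal, lt_abs] at h2
    rcases h2 with h2 | h2
    · exact ⟨k, hk, l, hl, by rwa [map_sub]⟩
    · exact ⟨l, hl, k, hk, by rwa [map_sub, ← neg_sub]⟩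
  choose k hk l hl hφkl using hkl
  obtain ⟨x, hx, hfreq⟩ := exists_norm_le_one_frequently_le_of_bidual
    (v := fun n => u (k n) - u (l n)) (M := M + M)
    (fun n => (norm_sub_le _ _).trans
      (add_le_add (hM _ (mem_range_self _)) (hM _ (mem_range_self _)))) hφ hφkl
    (sub_pos.2 hδδ)
  refine hcδ'.le.trans (le_iSup₂_of_le x hx (le_iInf fun n => ?_))
  obtain ⟨N, hN, hNx⟩ := frequently_atTop.1 hfreq n
  refine le_iSup₂_of_le (k N) (hN.trans (hk N)) (le_iSup₂_of_le (l N) (hN.trans (hl N)) ?_)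
  rw [ENNReal.le_ofReal_iff_toReal_le ENNReal.coe_ne_top (abs_nonneg _), ENNReal.coe_toReal]
  refine le_trans ?_ (le_abs_self _)
  simpa using hNx
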